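/- Let $F_n$ be the free group on $x_1,\dots,x_n$, let $H=F_n^{\mathrm{ab}}$ be its abelianization, and let $\mathfrak a:\mathbb Z[F_n]\to\mathbb Z[H]$ be the induced ring homomorphism. Let $\mathrm{Aut}\,F_n$ act on $F_n$ from the right, written $x\mapsto x^\sigma$, so that in a product $\sigma\tau$ the automorphism $\sigma$ is applied first. Let $\mathrm{IA}_n=\ker(\mathrm{Aut}\,F_n\to\mathrm{Aut}\,H)$. For a reduced word $w=x_{\mu_1}^{\epsilon_1}\cdots x_{\mu_r}^{\epsilon_r}\in F_n$ with $\epsilon_j=\pm1$, the Fox derivatives are $$\frac{\partial w}{\partial x_i}=\sum_{j=1}^{r}\epsilon_j\,\delta_{\mu_j,i}\,x_{\mu_1}^{\epsilon_1}\cdots x_{\mu_{j-1}}^{\epsilon_{j-1}}x_{\mu_j}^{\frac12(\epsilon_j-1)}\in\mathbb Z[F_n].$$ The Magnus representation is the homomorphism $$r_M:\mathrm{IA}_n\to\mathrm{GL}(n,\mathbb Z[H]),\qquad \sigma\mapsto\Bigl(\mathfrak a\Bigl(\frac{\partial (x_i^{\sigma})}{\partial x_j}\Bigr)\Bigr)_{i,j},$$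 and $\mathcal K_n$ denotes its kernel. **Proposition 5.1.** For $n=2$, $\mathrm{IA}_2$ equals the group $\mathrm{Inn}\,F_2$ of inner automorphisms of $F_2$, the map $g\mapsto\iota_g=(x\mapsto g^{-1}xg)$ is an isomorphism $F_2\to\mathrm{IA}_2$, and under this identification $$\mathcal K_2=[[F_2,F_2],[F_2,F_2]],$$ that is, $\mathcal K_2=\{\iota_g : g\in[[F_2,F_2],[F_2,F_2]]\}$. -/

import Mathlib

noncomputable section

namespace MagnusKernel

/-- The free group `F_n` of rank `n`, with fixed basis `x_i = FreeGroup.of i`. -/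
abbrev F (n : ℕ) : Type := FreeGroup (Fin n)

/-- `H = F_n^ab`, written multiplicatively. -/
abbrev H (n : ℕ) : Type := Abelianization (F n)

/-- `Aut G` acting on `G` from the right: in the product `σ * τ` the automorphism `σ` is
applied first. This is the opposite of Mathlib's `MulAut G`. -/
abbrev Aut (G : Type) [Group G] : Type := (MulAut G)ᵐᵒᵖ

/-- The right action `x ^ σ` of an automorphism `σ` on an element `x`. -/
def act {G : Type} [Group G] (σ : Aut G) (x : G) : G := σ.unop x

/-- The natural homomorphism `ρ : Aut F_n → Aut H`. -/
def rho (n : ℕ) : Aut (F n) →* Aut (H n) where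
  toFun σ := MulOpposite.op (MulEquiv.abelianizationCongr σ.unop)
  map_one' := by
    apply MulOpposite.unop_injective
    exact abelianizationCongr_refl
  map_mul' σ τ := by
    apply MulOpposite.unop_injective
    exact (abelianizationCongr_trans σ.unop τ.unop).symm

/-- The IA-automorphism group `IA_n` of `F_n`: the automorphisms acting trivially on `H`. -/
def IA (n : ℕ) : Subgroup (Aut (F n)) := (rho n).ker

/-- The Fox derivative with respect to `x_i` of a word
`x_{μ_1}^{ε_1} ⋯ x_{μ_r}^{ε_r}` (the letter `(μ, true)` is `x_μ`, the letter `(μ, false)` is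
`x_μ⁻¹`): the sum over all positions `j` with `μ_j = i` of
`ε_j x_{μ_1}^{ε_1} ⋯ x_{μ_{j-1}}^{ε_{j-1}} x_{μ_j}^{(ε_j - 1) / 2}`.
The last factor is trivial if `ε_j = 1`, and it is the whole letter `x_{μ_j}⁻¹` if `ε_j = -1`. -/
def foxWord {n : ℕ} (i : Fin n) (L : List (Fin n × Bool)) : MonoidAlgebra ℤ (F n) :=
  ∑ j : Fin L.length,
    if L[j].1 = i then
      if L[j].2 then MonoidAlgebra.single (FreeGroup.mk (L.take j)) 1
      else MonoidAlgebra.single (FreeGroup.mk (L.take (j + 1))) (-1)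
    else 0

/-- The Fox derivative `∂w/∂x_i ∈ ℤ[F_n]` of `w ∈ F_n`, computed from the reduced word of `w`. -/
def foxDeriv {n : ℕ} (i : Fin n) (w : F n) : MonoidAlgebra ℤ (F n) :=
  foxWord i w.toWord

/-- The ring homomorphism `𝔞 : ℤ[F_n] → ℤ[H]` induced by the abelianization. -/
def abRingHom (n : ℕ) : MonoidAlgebra ℤ (F n) →+* MonoidAlgebra ℤ (H n) :=
  MonoidAlgebra.mapDomainRingHom ℤ (Abelianization.of : F n →* H n)

/-- The Magnus matrix of `σ ∈ Aut F_n`: its `(i, j)` entry is the image in `ℤ[H]` of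
`∂(x_i ^ σ)/∂x_j`. -/
def magnusMatrix (n : ℕ) (σ : Aut (F n)) : Matrix (Fin n) (Fin n) (MonoidAlgebra ℤ (H n)) :=
  Matrix.of fun i j => abRingHom n (foxDeriv j (act σ (FreeGroup.of i)))

/-! Facts showing that the Magnus matrix is multiplicative on `IA_n`. -/

lemma foxWord_nil {n : ℕ} (i : Fin n) : foxWord i ([] : List (Fin n × Bool)) = 0 := by
  simp [foxWord]

lemma foxWord_cons {n : ℕ} (i : Fin n) (a : Fin n × Bool) (L : List (Fin n × Bool)) :
    foxWord i (a :: L) = foxWord i [a]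
      + MonoidAlgebra.single (FreeGroup.mk [a]) 1 * foxWord i L := by
  have key : ∀ M : List (Fin n × Bool), FreeGroup.mk (a :: M)
      = FreeGroup.mk [a] * FreeGroup.mk M := by
    intro M
    rw [FreeGroup.mul_mk]
    rfl
  unfold foxWord
  simp only [List.length_cons, List.length_nil]
  rw [Fin.sum_univ_succ, Finset.mul_sum]
  congr 1
  · simp
  · apply Finset.sum_congr rfl
    intro j _
    simp only [Fin.getElem_fin, Fin.val_succ, List.getElem_cons_succ, List.take_succ_cons]
    split_ifs
    · rw [MonoidAlgebra.single_mul_single, key, one_mul]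
    · rw [MonoidAlgebra.single_mul_single, key, one_mul]
    · rw [mul_zero]

lemma foxWord_append {n : ℕ} (i : Fin n) (L M : List (Fin n × Bool)) :
    foxWord i (L ++ M) = foxWord i L
      + MonoidAlgebra.single (FreeGroup.mk L) 1 * foxWord i M := by
  induction L with
  | nil =>
    rw [foxWord_nil, ← FreeGroup.one_eq_mk, ← MonoidAlgebra.one_def]
    simp
  | cons a L ih =>
    rw [List.cons_append, foxWord_cons, ih, foxWord_cons i a L, mul_add, ← mul_assoc,
      MonoidAlgebra.single_mul_single, FreeGroup.mul_mk, one_mul, add_assoc]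
    rfl

lemma foxWord_step {n : ℕ} (i : Fin n) {L M : List (Fin n × Bool)}
    (h : FreeGroup.Red.Step L M) : foxWord i L = foxWord i M := by
  obtain @⟨L₁, L₂, x, b⟩ := h
  have h2 : foxWord i [(x, b), (x, !b)] = 0 := by
    have hmk : FreeGroup.mk [(x, b), (x, !b)] = (1 : F n) := by
      rw [FreeGroup.one_eq_mk]
      exact Quot.sound (FreeGroup.Red.Step.not (L₁ := []) (L₂ := []))
    have hs (g : F n) : (MonoidAlgebra.single g (-1 : ℤ)) = -MonoidAlgebra.single g 1 := by
      rw [← MonoidAlgebra.single_neg]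
    unfold foxWord
    simp only [List.length_cons, List.length_nil]
    rw [Fin.sum_univ_two]
    cases b
    · by_cases hx : x = i <;> simp [hx, hs]
    · rw [Bool.not_true] at hmk
      by_cases hx : x = i
      · subst hx
        simp [hs, hmk, ← FreeGroup.one_eq_mk]
      · simp [hx]
  have hmk : FreeGroup.mk [(x, b), (x, !b)] = (1 : F n) := by
    rw [FreeGroup.one_eq_mk]
    exact Quot.sound (FreeGroup.Red.Step.not (L₁ := []) (L₂ := []))
  have h3 : foxWord i ((x, b) :: (x, !b) :: L₂) = foxWord i L₂ := by
    have := foxWord_append i [(x, b), (x, !b)] L₂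
    rw [h2, hmk, ← MonoidAlgebra.one_def, one_mul, zero_add] at this
    exact this
  rw [foxWord_append, h3, ← foxWord_append]

lemma foxWord_red {n : ℕ} (i : Fin n) {L M : List (Fin n × Bool)}
    (h : FreeGroup.Red L M) : foxWord i L = foxWord i M := by
  induction h with
  | refl => rfl
  | tail _ h ih => rw [ih, foxWord_step i h]

lemma foxDeriv_mul {n : ℕ} (i : Fin n) (u v : F n) :
    foxDeriv i (u * v) = foxDeriv i u + MonoidAlgebra.single u 1 * foxDeriv i v := by
  unfold foxDeriv
  rw [FreeGroup.toWord_mul, ← foxWord_red i FreeGroup.reduce.red, foxWord_append,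
    FreeGroup.mk_toWord]

lemma foxDeriv_one {n : ℕ} (i : Fin n) : foxDeriv i (1 : F n) = 0 := by
  simp [foxDeriv, foxWord_nil]

lemma foxDeriv_of {n : ℕ} (i k : Fin n) :
    foxDeriv i (FreeGroup.of k) = if k = i then 1 else 0 := by
  rw [foxDeriv, FreeGroup.toWord_of]
  unfold foxWord
  simp only [List.length_cons, List.length_nil]
  rw [Fin.sum_univ_one]
  simp [MonoidAlgebra.one_def, FreeGroup.one_eq_mk]

lemma abRingHom_single {n : ℕ} (u : F n) :
    abRingHom n (MonoidAlgebra.single u 1) = MonoidAlgebra.single (Abelianization.of u) 1 := by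
  simp [abRingHom]

lemma ab_foxDeriv_mul {n : ℕ} (i : Fin n) (u v : F n) :
    abRingHom n (foxDeriv i (u * v)) = abRingHom n (foxDeriv i u)
      + MonoidAlgebra.single (Abelianization.of u) 1 * abRingHom n (foxDeriv i v) := by
  rw [foxDeriv_mul, map_add, map_mul, abRingHom_single]

lemma ab_foxDeriv_inv {n : ℕ} (i : Fin n) (u : F n) :
    abRingHom n (foxDeriv i u⁻¹) =
      -(MonoidAlgebra.single (Abelianization.of u)⁻¹ 1 * abRingHom n (foxDeriv i u)) := by
  have h := ab_foxDeriv_mul i u⁻¹ u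
  rw [inv_mul_cancel, foxDeriv_one, map_zero, map_inv] at h
  exact eq_neg_of_add_eq_zero_left h.symm

lemma of_act {n : ℕ} {σ : Aut (F n)} (hσ : σ ∈ IA n) (w : F n) :
    Abelianization.of (act σ w) = Abelianization.of w := by
  have h : rho n σ = 1 := hσ
  have h2 := congrArg (fun τ : Aut (H n) => τ.unop (Abelianization.of w)) h
  exact h2

lemma chain_rule {n : ℕ} {σ : Aut (F n)} (hσ : σ ∈ IA n) (j : Fin n) (w : F n) :
    abRingHom n (foxDeriv j (act σ w)) =
      ∑ k, abRingHom n (foxDeriv k w) * abRingHom n (foxDeriv j (act σ (FreeGroup.of k))) := by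
  have hmul (u v : F n) : act σ (u * v) = act σ u * act σ v := map_mul σ.unop u v
  have hinv (u : F n) : act σ u⁻¹ = (act σ u)⁻¹ := map_inv σ.unop u
  have hone : act σ (1 : F n) = 1 := map_one σ.unop
  induction w using FreeGroup.induction_on with
  | C1 => simp [hone, foxDeriv_one]
  | of k =>
    simp [foxDeriv_of]
  | inv_of k ih =>
    rw [hinv, ab_foxDeriv_inv, ih, of_act hσ]
    simp only [ab_foxDeriv_inv, neg_mul, Finset.sum_neg_distrib, Finset.mul_sum, mul_assoc]
  | mul u v hu hv =>
    rw [hmul, ab_foxDeriv_mul, hu, hv, of_act hσ]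
    simp only [ab_foxDeriv_mul, add_mul, Finset.sum_add_distrib, Finset.mul_sum, mul_assoc]

/-- The Magnus representation `r_M : IA_n → GL(n, ℤ[H])`. -/
def magnusRep (n : ℕ) : IA n →* Matrix.GeneralLinearGroup (Fin n) (MonoidAlgebra ℤ (H n)) :=
  MonoidHom.toHomUnits
    { toFun := fun σ => magnusMatrix n σ
      map_one' := by
        ext1 i j
        simp [magnusMatrix, act, foxDeriv_of, Matrix.one_apply, apply_ite (abRingHom n)]
      map_mul' := by
        intro σ τ
        ext1 i j
        simp only [magnusMatrix, Matrix.mul_apply, Matrix.of_apply]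
        exact chain_rule τ.2 j (act σ.1 (FreeGroup.of i)) }

/-- The kernel `K_n` of the Magnus representation, a subgroup of `IA_n`. -/
def K (n : ℕ) : Subgroup (IA n) := (magnusRep n).ker

/-- The second derived subgroup `[[G, G], [G, G]]`. -/
def secondDerived (G : Type) [Group G] : Subgroup G :=
  ⁅⁅(⊤ : Subgroup G), (⊤ : Subgroup G)⁆, ⁅(⊤ : Subgroup G), (⊤ : Subgroup G)⁆⁆

/-- The homomorphism `G → Aut G` sending `g` to the inner automorphism
`ι_g = (x ↦ g⁻¹ x g)`, for automorphisms acting from the right. -/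
def inn (G : Type) [Group G] : G →* Aut G where
  toFun g := MulOpposite.op (MulAut.conj g⁻¹)
  map_one' := by simp
  map_mul' g h := by
    rw [mul_inv_rev, map_mul, MulOpposite.op_mul]

end MagnusKernel

end

/-! The Magnus matrix of `ι_g`, multiplied by the class of `g` in `ℤ[H]`, is `δ_ij + (x_i - 1)
∂g/∂x_j`. If it is the identity, the off-diagonal entries kill every `∂g/∂x_j`, since `x_i - 1` is
not a zero divisor; a diagonal entry then puts `g` in `[F, F]`. On `[F, F]` the abelianized Fox
derivatives are additive, and they determine the class in `[F, F]^ab` (`recover_abFox`), so they all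
vanish exactly on the second derived subgroup.

That `IA_2` is inner rests on Nielsen reduction. A shortest generating pair that is not `Good` would
be Nielsen reduced, hence would consist of basis letters up to sign, which is absurd; so every
generating pair is `Good`. Moves in a `Pos` pair only multiply, never divide, so exponent vectors
stay in one orthant and grow. A pair with the exponent vectors of `(x_0, x_1)` is too small to have
undergone a move, so it is a conjugate of `(x_0, x_1)`. -/

noncomputable section
namespace MagnusKernel

/-! ### Exponent sums and non-zero-divisors in `ℤ[H]`. -/

/-- The exponent sum of the generator `x_i`. -/
def expSum {n : ℕ} (i : Fin n) : F n →* Multiplicative ℤ :=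
  FreeGroup.lift fun j => if j = i then Multiplicative.ofAdd 1 else 1

lemma expSum_of {n : ℕ} (i j : Fin n) :
    expSum i (FreeGroup.of j) = if j = i then Multiplicative.ofAdd 1 else 1 := by
  simp [expSum]

lemma expSum_congr {n : ℕ} (i : Fin n) {u v : F n}
    (h : Abelianization.of u = Abelianization.of v) : expSum i u = expSum i v := by
  have := congrArg (Abelianization.lift (expSum i)) h
  simpa using this

lemma of_pow_ne_one {n : ℕ} (i : Fin n) {k : ℕ} (hk : k ≠ 0) :
    (Abelianization.of (FreeGroup.of i) : H n) ^ k ≠ 1 := by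
  intro h
  rw [← map_pow, ← map_one Abelianization.of] at h
  have := expSum_congr i h
  simp only [map_pow, expSum_of, if_true, map_one] at this
  rw [← ofAdd_nsmul, ofAdd_eq_one] at this
  simp at this
  exact hk this

/-- The support of `f` is stable under translation by `t`, which has infinite order, so it is
infinite unless empty. -/
lemma eq_zero_of_single_mul_eq {G : Type} [Group G] {t : G} (ht : ∀ k : ℕ, k ≠ 0 → t ^ k ≠ 1)
    {f : MonoidAlgebra ℤ G} (h : MonoidAlgebra.single t 1 * f = f) : f = 0 := by
  by_contra hf
  obtain ⟨g, hg⟩ : ∃ g, f.coeff g ≠ 0 := by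
    by_contra! hall
    exact hf (MonoidAlgebra.coeff_injective (Finsupp.ext hall))
  have hshift (g : G) : f.coeff (t * g) = f.coeff g := by
    conv_lhs => rw [← h]
    simp
  have hpow (k : ℕ) : f.coeff (t ^ k * g) = f.coeff g := by
    induction k with
    | zero => simp
    | succ k ih => rw [pow_succ', mul_assoc, hshift, ih]
  have hinj : Function.Injective fun k : ℕ => t ^ k * g := by
    intro a b hab
    wlog hle : a ≤ b generalizing a b
    · exact (this hab.symm (by omega)).symm
    have hab : t ^ a = t ^ b := mul_right_cancel hab
    by_contra hne
    apply ht (b - a) (by omega)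
    rw [pow_sub _ hle, hab, mul_inv_cancel]
  refine Set.infinite_of_injective_forall_mem hinj (s := (f.coeff.support : Set G)) ?_
    f.coeff.support.finite_toSet
  intro k
  simp [hpow, hg]

/-! ### Fox derivatives on the commutator subgroup. -/

/-- The image in `ℤ[H]` of the Fox derivative. -/
abbrev abFox {n : ℕ} (j : Fin n) (w : F n) : MonoidAlgebra ℤ (H n) := abRingHom n (foxDeriv j w)

section Kernel

variable (n : ℕ)

/-- A set-theoretic section of the abelianization. -/
def sect (h : H n) : F n := (QuotientGroup.mk_surjective h).choose

lemma of_sect (h : H n) : Abelianization.of (sect n h) = h :=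
  (QuotientGroup.mk_surjective h).choose_spec

/-- The Schreier-type element `s(h) w s(h w)⁻¹` of the commutator subgroup. -/
def schreier (h : H n) (w : F n) : commutator (F n) :=
  ⟨sect n h * w * (sect n (h * Abelianization.of w))⁻¹, by
    rw [← Abelianization.ker_of, MonoidHom.mem_ker]
    simp [of_sect]⟩

lemma schreier_mul (h : H n) (u v : F n) :
    schreier n h (u * v) = schreier n h u * schreier n (h * Abelianization.of u) v := by
  ext
  simp [schreier, mul_assoc]

/-- The additive map `ℤ[H]ⁿ → [F_n, F_n]^ab` through which the class of an element of `[F_n, F_n]`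
is recovered from its Fox derivatives. -/
def recover (f : Fin n → MonoidAlgebra ℤ (H n)) :
    Additive (Abelianization (commutator (F n))) :=
  ∑ j, (f j).coeff.sum fun h k =>
    k • Additive.ofMul (Abelianization.of (schreier n h (FreeGroup.of j)))

lemma recover_add (f g : Fin n → MonoidAlgebra ℤ (H n)) :
    recover n (f + g) = recover n f + recover n g := by
  simp only [recover, ← Finset.sum_add_distrib, Pi.add_apply, MonoidAlgebra.coeff_add]
  refine Finset.sum_congr rfl fun j _ => ?_
  exact Finsupp.sum_add_index' (by simp) (by intros; rw [add_smul])

/-- Both sides obey the same product rule (`schreier_mul`) and agree on generators. The base point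
`h` must vary, because the second factor of `u * v` starts at `h` times the class of `u`. -/
lemma recover_abFox (w : F n) : ∀ h : H n,
    recover n (fun j => MonoidAlgebra.single h 1 * abFox j w) =
      Additive.ofMul (Abelianization.of (schreier n h w)) := by
  have hmul (u v : F n) (h : H n) :
      recover n (fun j => MonoidAlgebra.single h 1 * abFox j (u * v)) =
        recover n (fun j => MonoidAlgebra.single h 1 * abFox j u) +
        recover n (fun j => MonoidAlgebra.single (h * Abelianization.of u) 1 * abFox j v) := by
    rw [← recover_add]
    congr 1
    ext1 j
    simp only [Pi.add_apply]
    rw [abFox, ab_foxDeriv_mul, mul_add, ← mul_assoc, MonoidAlgebra.single_mul_single, one_mul]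
  have hone (h : H n) : recover n (fun j => MonoidAlgebra.single h 1 * abFox j 1) = 0 := by
    simp [abFox, foxDeriv_one, recover]
  have sone (h : H n) : schreier n h 1 = 1 := by
    ext
    simp [schreier]
  induction w using FreeGroup.induction_on with
  | C1 => intro h; rw [hone, sone]; simp
  | of k =>
    intro h
    unfold recover
    rw [Finset.sum_eq_single k]
    · simp [abFox, foxDeriv_of]
    · intro j _ hj
      simp [abFox, foxDeriv_of, hj.symm]
    · simp
  | inv_of k ih =>
    intro h
    have h1 := hmul (FreeGroup.of k)⁻¹ (FreeGroup.of k) h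
    have h2 := schreier_mul n h (FreeGroup.of k)⁻¹ (FreeGroup.of k)
    rw [inv_mul_cancel, hone, ih] at h1
    rw [inv_mul_cancel, sone] at h2
    have h3 := congrArg (fun a => Additive.ofMul (Abelianization.of a)) h2
    simp only [map_one, ofMul_one, map_mul, ofMul_mul] at h3
    exact add_right_cancel (h1.symm.trans h3)
  | mul u v hu hv =>
    intro h
    rw [hmul, hu, hv, schreier_mul, map_mul, ofMul_mul]

lemma secondDerived_eq (G : Type) [Group G] :
    secondDerived G = (commutator (commutator G)).map (commutator G).subtype := by
  rw [Subgroup.map_subtype_commutator]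
  rfl

lemma mem_secondDerived_of_abFox {w : F n} (hw : w ∈ commutator (F n))
    (h : ∀ j, abFox j w = 0) : w ∈ secondDerived (F n) := by
  have h1 := recover_abFox n w 1
  simp only [h, mul_zero] at h1
  have h0 : recover n (fun _ => 0) = 0 := by simp [recover]
  rw [h0] at h1
  have h2 : schreier n 1 w ∈ commutator (commutator (F n)) := by
    rw [← Abelianization.ker_of (commutator (F n)), MonoidHom.mem_ker]
    exact h1.symm
  have h3 : Abelianization.of w = 1 := by
    rwa [← MonoidHom.mem_ker, Abelianization.ker_of]
  -- The section need not send 1 to 1, so `schreier n 1 w` is only a conjugate of `w` within `[F,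
  -- F]`.
  have hs : sect n 1 ∈ commutator (F n) := by
    rw [← Abelianization.ker_of, MonoidHom.mem_ker, of_sect]
  have h4 : schreier n 1 w = ⟨sect n 1, hs⟩ * ⟨w, hw⟩ * ⟨sect n 1, hs⟩⁻¹ := by
    ext
    simp [schreier, h3]
  rw [h4] at h2
  have h5 := (inferInstance : (commutator (commutator (F n))).Normal).mem_comm
    (by rwa [mul_assoc] at h2)
  rw [mul_assoc, inv_mul_cancel, mul_one] at h5
  rw [secondDerived_eq]
  exact ⟨_, h5, rfl⟩

/-- On `[F, F]` the coefficient in the product rule becomes 1, so `abFox j` is a homomorphism to a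
commutative group. -/
lemma abFox_of_mem_secondDerived {w : F n} (hw : w ∈ secondDerived (F n)) (j : Fin n) :
    abFox j w = 0 := by
  rw [secondDerived_eq] at hw
  obtain ⟨w, hw, rfl⟩ := hw
  let φ : commutator (F n) →* Multiplicative (MonoidAlgebra ℤ (H n)) :=
    { toFun := fun u => Multiplicative.ofAdd (abFox j (u : F n))
      map_one' := by simp [abFox, foxDeriv_one]
      map_mul' := by
        intro u v
        have hu : Abelianization.of (u : F n) = 1 := by
          rw [← MonoidHom.mem_ker, Abelianization.ker_of]
          exact u.2
        rw [Subgroup.coe_mul, abFox, ab_foxDeriv_mul, hu, ← MonoidAlgebra.one_def, one_mul,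
          ofAdd_add] }
  exact congrArg Multiplicative.toAdd (Abelianization.commutator_subset_ker φ hw)

end Kernel

/-! ### The Magnus matrix of an inner automorphism. -/

lemma act_inn {G : Type} [Group G] (g x : G) : act (inn G g) x = g⁻¹ * x * g := by
  simp [act, inn]

lemma inn_mem_IA (n : ℕ) (g : F n) : inn (F n) g ∈ IA n := by
  rw [IA, MonoidHom.mem_ker]
  apply MulOpposite.unop_injective
  ext x
  obtain ⟨x, rfl⟩ := QuotientGroup.mk_surjective x
  change Abelianization.of (act (inn (F n) g) x) = Abelianization.of x
  rw [act_inn]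
  simp

lemma single_mul_magnusMatrix_inn (n : ℕ) (g : F n) (i j : Fin n) :
    MonoidAlgebra.single (Abelianization.of g) 1 * magnusMatrix n (inn (F n) g) i j =
      (if i = j then 1 else 0) +
        (MonoidAlgebra.single (Abelianization.of (FreeGroup.of i)) 1 - 1) * abFox j g := by
  rw [magnusMatrix, Matrix.of_apply, act_inn, mul_assoc, ab_foxDeriv_mul, ab_foxDeriv_inv, map_inv,
    mul_add, mul_neg, ← mul_assoc, ← mul_assoc, MonoidAlgebra.single_mul_single, mul_inv_cancel,
    one_mul, ← MonoidAlgebra.one_def, one_mul, one_mul, ab_foxDeriv_mul, foxDeriv_of,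
    apply_ite (abRingHom n), map_one, map_zero, abFox]
  ring

lemma magnusMatrix_inn_eq_one_iff {n : ℕ} (hn : 2 ≤ n) (g : F n) :
    magnusMatrix n (inn (F n) g) = 1 ↔ g ∈ secondDerived (F n) := by
  constructor
  · intro h
    have key (i j : Fin n) := single_mul_magnusMatrix_inn n g i j
    simp only [h, Matrix.one_apply] at key
    have hfox (j : Fin n) : abFox j g = 0 := by
      -- A second generator provides an off-diagonal entry in column `j`.
      have : Nontrivial (Fin n) := Fin.nontrivial_iff_two_le.mpr hn
      obtain ⟨i, hij⟩ := exists_ne j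
      have h1 := key i j
      rw [if_neg hij, mul_zero, zero_add, sub_mul, one_mul] at h1
      exact eq_zero_of_single_mul_eq (fun k hk => of_pow_ne_one i hk) (sub_eq_zero.mp h1.symm)
    refine mem_secondDerived_of_abFox n ?_ hfox
    have h1 := key ⟨0, by omega⟩ ⟨0, by omega⟩
    rw [hfox, mul_zero, add_zero, if_pos rfl, mul_one, MonoidAlgebra.one_def,
      MonoidAlgebra.single_left_inj one_ne_zero] at h1
    rwa [← Abelianization.ker_of, MonoidHom.mem_ker]
  · intro hg
    have hg1 : Abelianization.of g = 1 := by
      rw [← MonoidHom.mem_ker, Abelianization.ker_of]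
      exact Subgroup.commutator_le_self _ hg
    ext1 i j
    have h1 := single_mul_magnusMatrix_inn n g i j
    rwa [hg1, ← MonoidAlgebra.one_def, one_mul, abFox_of_mem_secondDerived n hg, mul_zero,
      add_zero, ← Matrix.one_apply] at h1

lemma mem_K_iff {n : ℕ} (σ : IA n) : σ ∈ K n ↔ magnusMatrix n σ = 1 := by
  rw [K, MonoidHom.mem_ker, Units.ext_iff]
  rfl

/-! ### Cancellation in free groups. -/

/-- The length of the longest common prefix of two lists. -/
def lcp {β : Type} [DecidableEq β] : List β → List β → ℕ
  | a :: l, b :: m => if a = b then lcp l m + 1 else 0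
  | _, _ => 0

lemma le_lcp_iff {β : Type} [DecidableEq β] (k : ℕ) (l m : List β) :
    k ≤ lcp l m ↔ k ≤ l.length ∧ k ≤ m.length ∧ l.take k = m.take k := by
  induction l generalizing k m with
  | nil => simp +contextual [lcp]
  | cons a l ih =>
    cases m with
    | nil => simp +contextual [lcp]
    | cons b m =>
      cases k with
      | zero => simp
      | succ k =>
        by_cases hab : a = b
        · simp [lcp, hab, ih]
        · simp [lcp, hab]

section Length

open FreeGroup

variable {α : Type} [DecidableEq α]

lemma isReduced_invRev {L : List (α × Bool)} (h : IsReduced L) : IsReduced (invRev L) := by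
  rw [isReduced_iff_reduce_eq] at h ⊢
  rw [reduce_invRev, h]

lemma length_reduce_invRev_append (l m : List (α × Bool)) (hl : IsReduced l) (hm : IsReduced m) :
    (reduce (invRev l ++ m)).length + 2 * lcp l m = l.length + m.length := by
  induction l generalizing m with
  | nil => simp [lcp, hm.reduce_eq]
  | cons a l ih =>
    cases m with
    | nil => simp [lcp, (isReduced_invRev hl).reduce_eq]
    | cons b m =>
      by_cases hab : a = b
      · subst hab
        have h1 : reduce (invRev (a :: l) ++ a :: m) = reduce (invRev l ++ m) := by
          apply reduce.sound
          have hc (L : List (α × Bool)) : mk (a :: L) = mk [a] * mk L := by rw [mul_mk]; rfl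
          rw [← mul_mk, ← mul_mk, ← inv_mk, ← inv_mk, hc l, hc m]
          group
        have := ih m (hl.infix (List.suffix_cons _ _).isInfix)
          (hm.infix (List.suffix_cons _ _).isInfix)
        rw [h1]
        simp only [lcp, if_true, List.length_cons]
        omega
      · have h1 : IsReduced (invRev (a :: l) ++ b :: m) := by
          refine List.isChain_append.mpr ⟨isReduced_invRev hl, hm, ?_⟩
          intro x hx y hy hxy
          rw [invRev_cons] at hx
          simp [invRev] at hx hy
          subst hx hy
          by_contra hne
          apply hab
          obtain ⟨a1, a2⟩ := a
          obtain ⟨b1, b2⟩ := b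
          cases a2 <;> cases b2 <;> simp_all
        rw [h1.reduce_eq]
        simp [lcp, hab]

/-- The length of the longest common prefix of the reduced words of `u` and `v`. -/
def gp (u v : FreeGroup α) : ℕ := lcp u.toWord v.toWord

lemma norm_inv_mul (u v : FreeGroup α) : (u⁻¹ * v).norm + 2 * gp u v = u.norm + v.norm := by
  have := length_reduce_invRev_append u.toWord v.toWord isReduced_toWord isReduced_toWord
  rwa [← toWord_inv, ← toWord_mul] at this

lemma gp_comm (u v : FreeGroup α) : gp u v = gp v u := by
  apply le_antisymm <;> · rw [gp, gp, le_lcp_iff]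
                          have := (le_lcp_iff _ _ _).mp (le_refl (lcp u.toWord v.toWord))
                          have := (le_lcp_iff _ _ _).mp (le_refl (lcp v.toWord u.toWord))
                          tauto

lemma gp_ultra (u v w : FreeGroup α) : min (gp u v) (gp v w) ≤ gp u w := by
  have h1 := (le_lcp_iff _ _ _).mp (min_le_left (gp u v) (gp v w))
  have h2 := (le_lcp_iff _ _ _).mp (min_le_right (gp u v) (gp v w))
  exact (le_lcp_iff _ _ _).mpr ⟨h1.1, h2.2.1, h1.2.2.trans h2.2.2⟩

lemma gp_le_left (u v : FreeGroup α) : gp u v ≤ u.norm :=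
  ((le_lcp_iff _ _ _).mp (le_refl (gp u v))).1

lemma norm_mul_add (u v : FreeGroup α) : (u * v).norm + 2 * gp u⁻¹ v = u.norm + v.norm := by
  have := norm_inv_mul u⁻¹ v
  rwa [inv_inv, norm_inv_eq] at this

/-- The word of `u` splits into the prefix surviving in `u * w` and the suffix cancelled by `w`. -/
lemma gp_mul_self (u w : FreeGroup α) : gp u (u * w) + gp u⁻¹ w = u.norm := by
  have h1 := norm_mul_add u w
  have h2 := norm_inv_mul u (u * w)
  rw [inv_mul_cancel_left] at h2
  omega

/-- With `u = c r c⁻¹` and `r` cyclically reduced, `c r r c⁻¹` is reduced, so squaring adds the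
length of `r`. -/
lemma norm_lt_norm_mul_self {u : FreeGroup α} (hu : u ≠ 1) : u.norm < (u * u).norm := by
  have h1 := reduceCyclically.reduce_flatten_replicate_succ (L := u.toWord) isReduced_toWord 1
  have h2 := reduceCyclically.conj_conjugator_reduceCyclically u.toWord
  have h3 : reduce (List.replicate 2 u.toWord).flatten = (u * u).toWord := by
    simp [toWord_mul]
  rw [h3] at h1
  have h4 := congrArg List.length h1
  have h5 := congrArg List.length h2
  have h6 : 0 < (reduceCyclically u.toWord).length := by
    rw [List.length_pos_iff]
    intro h
    rw [h, List.append_nil] at h2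
    apply hu
    rw [← mk_toWord (x := u), ← h2, ← mul_mk, ← inv_mk, mul_inv_cancel]
  simp at h4 h5
  unfold FreeGroup.norm
  omega

lemma two_mul_gp_inv_self_lt {u : FreeGroup α} (hu : u ≠ 1) : 2 * gp u⁻¹ u < u.norm := by
  have h1 := norm_lt_norm_mul_self hu
  have h2 := norm_mul_add u u
  omega

/-- If the first half of `b` cancels against `a` in `a * b` and the second half cancels in `b * a`,
then conjugating `(a * b, b)` suitably gives a pair of total length less than that of `(a, b)`. -/
lemma exists_conj_norm_lt {a b : FreeGroup α} (hb : b ≠ 1) (h1 : 2 * gp a⁻¹ b = b.norm)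
    (h2 : 2 * gp b⁻¹ a = b.norm) (hab : b.norm ≤ a.norm) :
    ∃ q : FreeGroup α,
      (q * (a * b) * q⁻¹).norm + (q * b * q⁻¹).norm < a.norm + b.norm := by
  obtain ⟨k, hk⟩ : ∃ k, k = gp a⁻¹ b := ⟨_, rfl⟩
  have hk2 : k = gp b⁻¹ a := by omega
  have e1 := ((le_lcp_iff _ _ _).mp (le_refl (gp a⁻¹ b))).2.2
  have e2 := ((le_lcp_iff _ _ _).mp (le_refl (gp b⁻¹ a))).2.2
  rw [← hk] at e1
  rw [← hk2] at e2
  have hB : b.toWord.length = 2 * k := by change b.norm = _; omega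
  have hA : 2 * k ≤ a.toWord.length := by change _ ≤ a.norm; omega
  have hpos : 0 < k := by
    have : b.norm ≠ 0 := by rwa [Ne, FreeGroup.norm_eq_zero]
    omega
  obtain ⟨A, hAdef⟩ : ∃ A, A = a.toWord := ⟨_, rfl⟩
  obtain ⟨B, hBdef⟩ : ∃ B, B = b.toWord := ⟨_, rfl⟩
  rw [toWord_inv, ← hAdef, ← hBdef] at e1
  rw [toWord_inv, ← hAdef, ← hBdef] at e2
  rw [← hBdef] at hB
  rw [← hAdef] at hA
  have t1 (L : List (α × Bool)) : invRev ((invRev L).take k) = L.drop (L.length - k) := by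
    simp [invRev, List.take_reverse, List.map_drop, Function.comp_def]
  have hdropA : A.drop (A.length - k) = invRev (B.take k) := by rw [← e1, t1]
  have hdropB : B.drop k = invRev (A.take k) := by
    rw [← e2, t1, hB]
    congr 1
    omega
  obtain ⟨M, hM, hMl⟩ : ∃ M, A = A.take k ++ M ++ invRev (B.take k) ∧
      M.length + 2 * k = A.length := by
    refine ⟨(A.drop k).take (A.length - 2 * k), ?_, ?_⟩
    · rw [← hdropA, List.append_assoc]
      have : A.drop (A.length - k) = (A.drop k).drop (A.length - 2 * k) := by
        rw [List.drop_drop]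
        congr 1
        omega
      rw [this, List.take_append_drop, List.take_append_drop]
    · simp
      omega
  have hBeq : B = B.take k ++ invRev (A.take k) := by rw [← hdropB, List.take_append_drop]
  have ha : a = mk (A.take k) * mk M * (mk (B.take k))⁻¹ := by
    rw [inv_mk, mul_mk, mul_mk, ← hM, hAdef, mk_toWord]
  have hb' : b = mk (B.take k) * (mk (A.take k))⁻¹ := by
    rw [inv_mk, mul_mk, ← hBeq, hBdef, mk_toWord]
  -- With `P`, `Q` the prefixes of length `k`, `a = P M Q⁻¹` and `b = Q P⁻¹`. Conjugation turns `(a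
  -- * b, b)` into `(M, P⁻¹ Q)`, of total length at most that of `a`.
  refine ⟨(mk (A.take k))⁻¹, ?_⟩
  have g1 : (mk (A.take k))⁻¹ * (a * b) * (mk (A.take k))⁻¹⁻¹ = mk M := by
    rw [ha, hb']
    group
  have g2 : (mk (A.take k))⁻¹ * b * (mk (A.take k))⁻¹⁻¹ = (mk (A.take k))⁻¹ * mk (B.take k) := by
    rw [hb']
    group
  rw [g1, g2]
  have n1 : (mk M).norm ≤ M.length := norm_mk_le
  have n2 := norm_mul_le (mk (A.take k))⁻¹ (mk (B.take k))
  rw [norm_inv_eq] at n2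
  have n3 : (mk (A.take k)).norm ≤ (A.take k).length := norm_mk_le
  have n4 : (mk (B.take k)).norm ≤ (B.take k).length := norm_mk_le
  rw [List.length_take] at n3 n4
  have n5 : a.norm = A.length := by rw [hAdef]; rfl
  have n6 : b.norm = B.length := by rw [hBdef]; rfl
  omega

end Length

/-! ### Nielsen-reduced families. -/

section NielsenReduced

open FreeGroup

variable {α ι : Type} [DecidableEq α]

/-- The element of the family `g` or its inverse named by a letter. -/
def letter (g : ι → FreeGroup α) (a : ι × Bool) : FreeGroup α :=
  cond a.2 (g a.1) (g a.1)⁻¹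

/-- Two letters are adjacent if they may follow each other in a reduced word. -/
def Adjacent (a b : ι × Bool) : Prop := a.1 = b.1 → a.2 = b.2

/-- Nielsen's conditions on a family of elements of a free group. -/
structure NielsenReduced (g : ι → FreeGroup α) : Prop where
  ne_one : ∀ a, letter g a ≠ 1
  left_le : ∀ a b, Adjacent a b → 2 * gp (letter g a)⁻¹ (letter g b) ≤ (letter g a).norm
  right_le : ∀ a b, Adjacent a b → 2 * gp (letter g a)⁻¹ (letter g b) ≤ (letter g b).norm
  middle_lt : ∀ a b c, Adjacent a b → Adjacent b c →
    gp (letter g a)⁻¹ (letter g b) + gp (letter g b)⁻¹ (letter g c) < (letter g b).norm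

variable {g : ι → FreeGroup α}

lemma NielsenReduced.norm_pos (hg : NielsenReduced g) (a : ι × Bool) : 0 < (letter g a).norm := by
  rw [Nat.pos_iff_ne_zero, Ne, FreeGroup.norm_eq_zero]
  exact hg.ne_one a

/-- By `middle_lt`, the part of `b` surviving its right neighbours is longer than what `a` cancels.
The ultrametric inequality then prevents `a` from cancelling further. -/
lemma NielsenReduced.gp_prod_le (hg : NielsenReduced g) (L : List (ι × Bool)) :
    ∀ a b, IsReduced (a :: b :: L) →
      gp (letter g a)⁻¹ (letter g b * (L.map (letter g)).prod) ≤ gp (letter g a)⁻¹ (letter g b) ∧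
      gp (letter g a)⁻¹ (letter g b) < (letter g b * (L.map (letter g)).prod).norm := by
  induction L with
  | nil =>
    intro a b h
    have h1 := hg.right_le a b (List.isChain_cons_cons.mp h).1
    have h2 := hg.norm_pos b
    simp only [List.map_nil, List.prod_nil, mul_one]
    omega
  | cons c L ih =>
    intro a b h
    obtain ⟨hab, h'⟩ := List.isChain_cons_cons.mp h
    have h1 := (ih b c h').1
    have h2 := hg.middle_lt a b c hab (List.isChain_cons_cons.mp h').1
    rw [List.map_cons, List.prod_cons]
    have h3 := gp_mul_self (letter g b) (letter g c * (L.map (letter g)).prod)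
    have h4 := gp_ultra (letter g a)⁻¹
      (letter g b * (letter g c * (L.map (letter g)).prod)) (letter g b)
    have h5 := gp_le_left (letter g b * (letter g c * (L.map (letter g)).prod)) (letter g b)
    rw [gp_comm _ (letter g b)] at h4 h5
    omega

lemma NielsenReduced.two_le_norm (hg : NielsenReduced g) {a b : ι × Bool} {L : List (ι × Bool)}
    (h : IsReduced (a :: b :: L)) : 2 ≤ (((a :: b :: L).map (letter g)).prod).norm := by
  have h1 := hg.gp_prod_le L a b h
  have h2 := hg.left_le a b (List.isChain_cons_cons.mp h).1
  have h3 := hg.norm_pos a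
  have h4 := norm_mul_add (letter g a) (letter g b * (L.map (letter g)).prod)
  simp only [List.map_cons, List.prod_cons]
  omega

/-- A basis element has length 1, while reduced words with at least two letters have values of
length at least 2. -/
lemma NielsenReduced.exists_letter_eq_of [DecidableEq ι] (hg : NielsenReduced g)
    (hsurj : Subgroup.closure (Set.range g) = ⊤) (k : α) :
    ∃ a, letter g a = FreeGroup.of k := by
  rw [← FreeGroup.range_lift_eq_closure] at hsurj
  obtain ⟨w, hw⟩ := MonoidHom.range_eq_top.mp hsurj (FreeGroup.of k)
  have h1 : (w.toWord.map (letter g)).prod = FreeGroup.of k := by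
    rw [← hw]
    conv_rhs => rw [← mk_toWord (x := w), FreeGroup.lift_mk]
    rfl
  have hred : IsReduced w.toWord := isReduced_toWord
  match hL : w.toWord with
  | [] =>
    rw [hL] at h1
    exact absurd h1 (one_ne_of k)
  | [a] =>
    rw [hL] at h1
    exact ⟨a, by simpa using h1⟩
  | a :: b :: L =>
    rw [hL] at hred h1
    have := hg.two_le_norm hred
    rw [h1, norm_of] at this
    omega

end NielsenReduced

/-! ### Positive moves on pairs. -/

/-- Pairs obtained, up to simultaneous conjugation, by the moves `(u, v) ↦ (u, uv)` and
`(u, v) ↦ (uv, v)` from a pair consisting of one of `x_0, x_0⁻¹` and one of `x_1, x_1⁻¹`. -/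
inductive Pos : F 2 → F 2 → Prop
  | base (i j : Fin 2) (s t : Bool) (h : i ≠ j) : Pos (FreeGroup.mk [(i, s)]) (FreeGroup.mk [(j, t)])
  | mul_right {u v : F 2} : Pos u v → Pos u (u * v)
  | mul_left {u v : F 2} : Pos u v → Pos (u * v) v
  | conj (g : F 2) {u v : F 2} : Pos u v → Pos (g * u * g⁻¹) (g * v * g⁻¹)

namespace Pos

variable {u v : F 2}

lemma of_conj (g : F 2) {u' v' : F 2} (h : Pos u v) (hu : u' = g * u * g⁻¹)
    (hv : v' = g * v * g⁻¹) : Pos u' v' := by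
  subst hu hv
  exact h.conj g

/-- Swapping reverses the order of the product in a move; conjugation restores it. -/
lemma swap (h : Pos u v) : Pos v u := by
  induction h with
  | base i j s t h => exact base j i t s h.symm
  | @mul_right u v _ ih => exact ih.mul_left.of_conj u (by group) (by group)
  | @mul_left u v _ ih => exact ih.mul_right.of_conj v⁻¹ (by group) (by group)
  | conj g _ ih => exact ih.conj g

lemma inv (h : Pos u v) : Pos u⁻¹ v⁻¹ := by
  induction h with
  | base i j s t h => exact base i j (!s) (!t) h
  | @mul_right u v _ ih => exact ih.mul_right.of_conj u (by group) (by group)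
  | @mul_left u v _ ih => exact ih.mul_left.of_conj v⁻¹ (by group) (by group)
  | conj g _ ih => exact ih.of_conj g (by group) (by group)

end Pos

/-- Pairs that satisfy `Pos` after possibly inverting an entry. -/
def Good (u v : F 2) : Prop := Pos u v ∨ Pos u⁻¹ v

namespace Good

variable {u v : F 2}

lemma inv_left (h : Good u v) : Good u⁻¹ v := by
  rcases h with h | h
  · exact Or.inr (by rwa [inv_inv])
  · exact Or.inl h

lemma inv_right (h : Good u v) : Good u v⁻¹ := by
  rcases h with h | h
  · exact Or.inr h.inv
  · exact Or.inl (by simpa using h.inv)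

lemma swap (h : Good u v) : Good v u := by
  rcases h with h | h
  · exact Or.inl h.swap
  · exact Or.inr (by simpa using h.swap.inv)

lemma conj (h : Good u v) (g : F 2) : Good (g * u * g⁻¹) (g * v * g⁻¹) := by
  rcases h with h | h
  · exact Or.inl (h.conj g)
  · exact Or.inr (h.of_conj g (by group) (by group))

lemma conj_iff (g : F 2) : Good (g * u * g⁻¹) (g * v * g⁻¹) ↔ Good u v := by
  refine ⟨fun h => ?_, fun h => h.conj g⟩
  convert h.conj g⁻¹ using 1 <;> group

lemma inv_left_iff : Good u⁻¹ v ↔ Good u v :=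
  ⟨fun h => by simpa using h.inv_left, inv_left⟩

lemma inv_right_iff : Good u v⁻¹ ↔ Good u v :=
  ⟨fun h => by simpa using h.inv_right, inv_right⟩

/-- Division either undoes the last move or, after inverting an entry and conjugating, is again a
positive move. -/
lemma of_pos (h : Pos u v) : Good u (u⁻¹ * v) := by
  induction h with
  | base i j s t h => exact inv_left_iff.mp (Or.inl (Pos.base i j (!s) t h).mul_right)
  | @mul_right u v h _ => exact Or.inl (by rwa [inv_mul_cancel_left])
  | @mul_left u v h _ =>
    rw [← conj_iff v, ← inv_right_iff]
    refine Or.inl (h.swap.mul_left.of_conj 1 ?_ ?_) <;> group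
  | @conj g u v _ ih =>
    convert ih.conj g using 1
    group

lemma mul_right (h : Good u v) : Good u (u * v) := by
  rcases h with h | h
  · exact Or.inl h.mul_right
  · have := of_pos h
    rw [inv_inv, inv_left_iff] at this
    exact this

lemma of_mul_right (h : Good u (u * v)) : Good u v := by
  have := (inv_left_iff.mpr h).mul_right
  rwa [inv_mul_cancel_left, inv_left_iff] at this

lemma of_mul_left (h : Good (u * v) v) : Good u v := by
  rw [← inv_left_iff, ← inv_right_iff]
  refine (of_mul_right (u := v⁻¹) (v := u⁻¹) ?_).swap
  rw [← mul_inv_rev]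
  exact h.swap.inv_left.inv_right

end Good

/-! ### Minimal counterexamples are Nielsen reduced. -/

open FreeGroup (mk of)

/-- A generating pair that is not `Good`, of minimal total length. -/
structure MinimalBad (u v : F 2) : Prop where
  closure_eq : Subgroup.closure {u, v} = ⊤
  not_good : ¬ Good u v
  good_of_lt : ∀ u' v' : F 2, Subgroup.closure {u', v'} = ⊤ →
    u'.norm + v'.norm < u.norm + v.norm → Good u' v'

lemma closure_pair_eq_top_of_mem {G : Type} [Group G] {u v u' v' : G}
    (h : Subgroup.closure {u, v} = ⊤) (hu : u ∈ Subgroup.closure {u', v'})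
    (hv : v ∈ Subgroup.closure {u', v'}) : Subgroup.closure {u', v'} = ⊤ := by
  rw [eq_top_iff, ← h, Subgroup.closure_le]
  rintro x (rfl | rfl)
  exacts [hu, hv]

lemma closure_pair_conj_eq_top {G : Type} [Group G] {u v : G}
    (h : Subgroup.closure {u, v} = ⊤) (g : G) :
    Subgroup.closure {g * u * g⁻¹, g * v * g⁻¹} = ⊤ := by
  have h1 : ({g * u * g⁻¹, g * v * g⁻¹} : Set G) = MulAut.conj g '' {u, v} := by
    rw [Set.image_pair]
    rfl
  rw [h1]
  have := MonoidHom.map_closure (MulAut.conj g).toMonoidHom {u, v}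
  rw [h, Subgroup.map_top_of_surjective _ (MulAut.conj g).surjective] at this
  exact this.symm

namespace MinimalBad

variable {u v : F 2}

lemma left_mem (u v : F 2) : u ∈ Subgroup.closure {u, v} := Subgroup.subset_closure (by simp)

lemma right_mem (u v : F 2) : v ∈ Subgroup.closure {u, v} := Subgroup.subset_closure (by simp)

lemma swap (h : MinimalBad u v) : MinimalBad v u where
  closure_eq := Set.pair_comm u v ▸ h.closure_eq
  not_good hg := h.not_good hg.swap
  good_of_lt u' v' h1 h2 := h.good_of_lt u' v' h1 (by omega)

lemma inv_left (h : MinimalBad u v) : MinimalBad u⁻¹ v where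
  closure_eq := closure_pair_eq_top_of_mem h.closure_eq
    ((Subgroup.inv_mem_iff _).mp (left_mem _ _)) (right_mem _ _)
  not_good hg := h.not_good (Good.inv_left_iff.mp hg)
  good_of_lt u' v' h1 h2 := h.good_of_lt u' v' h1 (by rwa [FreeGroup.norm_inv_eq] at h2)

lemma inv_right (h : MinimalBad u v) : MinimalBad u v⁻¹ := h.swap.inv_left.swap

lemma left_ne_one (h : MinimalBad u v) : u ≠ 1 := by
  rintro rfl
  have h1 : ∀ x : F 2, x ∈ Subgroup.zpowers v := by
    intro x
    have hx : x ∈ Subgroup.closure {1, v} := h.closure_eq ▸ Subgroup.mem_top x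
    refine (Subgroup.closure_le _).mpr ?_ hx
    rintro y (rfl | rfl)
    exacts [one_mem _, Subgroup.mem_zpowers _]
  obtain ⟨a, ha⟩ := h1 (of 0)
  obtain ⟨b, hb⟩ := h1 (of 1)
  have h2 : (of 0 * of 1 : F 2) = of 1 * of 0 := by
    rw [← ha, ← hb]
    exact (Commute.zpow_zpow_self v a b)
  exact absurd h2 (by decide)

lemma two_mul_gp_le_left (h : MinimalBad u v) : 2 * gp u⁻¹ v ≤ u.norm := by
  by_contra! hlt
  have h1 := norm_mul_add u v
  refine h.not_good (Good.of_mul_right (h.good_of_lt u (u * v) ?_ (by omega)))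
  exact closure_pair_eq_top_of_mem h.closure_eq (left_mem _ _)
    (((Subgroup.closure {u, u * v}).mul_mem_cancel_left (left_mem _ _)).mp (right_mem _ _))

lemma closure_mul_left (h : MinimalBad u v) : Subgroup.closure {u * v, v} = ⊤ :=
  closure_pair_eq_top_of_mem h.closure_eq
    (((Subgroup.closure {u * v, v}).mul_mem_cancel_right (right_mem _ _)).mp (left_mem _ _))
    (right_mem _ _)

lemma two_mul_gp_le_right (h : MinimalBad u v) : 2 * gp u⁻¹ v ≤ v.norm := by
  by_contra! hlt
  have h1 := norm_mul_add u v
  exact h.not_good (Good.of_mul_left (h.good_of_lt (u * v) v h.closure_mul_left (by omega)))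

/-- Failure forces exactly half of `v` to cancel on each side; no single move shortens such a pair,
but a move followed by a conjugation does. -/
lemma gp_add_gp_lt (h : MinimalBad u v) : gp u⁻¹ v + gp v⁻¹ u < v.norm := by
  by_contra! hle
  have h1 := h.two_mul_gp_le_left
  have h2 := h.two_mul_gp_le_right
  have h3 := h.swap.two_mul_gp_le_left
  obtain ⟨q, hq⟩ := exists_conj_norm_lt h.swap.left_ne_one (a := u) (b := v)
    (by omega) (by omega) (by omega)
  exact h.not_good (Good.of_mul_left ((Good.conj_iff q).mp
    (h.good_of_lt _ _ (closure_pair_conj_eq_top h.closure_mul_left q) hq)))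

lemma letter (h : MinimalBad u v) {a b : Fin 2 × Bool} (hab : a.1 ≠ b.1) :
    MinimalBad (letter ![u, v] a) (MagnusKernel.letter ![u, v] b) := by
  obtain ⟨i, s⟩ := a
  obtain ⟨j, t⟩ := b
  have key {u v : F 2} (h : MinimalBad u v) :
      MinimalBad (cond s u u⁻¹) (cond t v v⁻¹) := by
    cases s <;> cases t
    exacts [h.inv_left.inv_right, h.inv_left, h.inv_right, h]
  fin_cases i <;> fin_cases j
  · exact absurd rfl hab
  · exact key h
  · exact key h.swap
  · exact absurd rfl hab

lemma nielsenReduced (h : MinimalBad u v) : NielsenReduced ![u, v] := by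
  have hne (a : Fin 2 × Bool) : MagnusKernel.letter ![u, v] a ≠ 1 := by
    refine (h.letter (a := a) (b := (a.1 + 1, true)) ?_).left_ne_one
    obtain ⟨i, s⟩ := a
    fin_cases i <;> simp
  have hinv (a b : Fin 2 × Bool) (h1 : a.1 = b.1) (h2 : a.2 ≠ b.2) :
      MagnusKernel.letter ![u, v] a = (MagnusKernel.letter ![u, v] b)⁻¹ := by
    obtain ⟨i, s⟩ := a
    obtain ⟨j, t⟩ := b
    obtain rfl : i = j := h1
    cases s <;> cases t <;> simp_all [MagnusKernel.letter]
  have hle (a b : Fin 2 × Bool) (hab : Adjacent a b) :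
      2 * gp (MagnusKernel.letter ![u, v] a)⁻¹ (MagnusKernel.letter ![u, v] b) ≤
        (MagnusKernel.letter ![u, v] a).norm ∧
      2 * gp (MagnusKernel.letter ![u, v] a)⁻¹ (MagnusKernel.letter ![u, v] b) ≤
        (MagnusKernel.letter ![u, v] b).norm := by
    by_cases h1 : a.1 = b.1
    · obtain rfl : a = b := Prod.ext h1 (hab h1)
      have := two_mul_gp_inv_self_lt (hne a)
      omega
    · exact ⟨(h.letter h1).two_mul_gp_le_left, (h.letter h1).two_mul_gp_le_right⟩
  refine ⟨hne, fun a b hab => (hle a b hab).1, fun a b hab => (hle a b hab).2, ?_⟩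
  intro a b c hab hbc
  have h1 := (hle a b hab).2
  have h2 := (hle b c hbc).1
  have h3 := two_mul_gp_inv_self_lt (hne b)
  by_cases hab1 : a.1 = b.1
  · obtain rfl : a = b := Prod.ext hab1 (hab hab1)
    omega
  by_cases hbc1 : b.1 = c.1
  · obtain rfl : b = c := Prod.ext hbc1 (hbc hbc1)
    omega
  -- There are only two indices, so `c` is `a` or its inverse. In the inverse case the ultrametric
  -- inequality excludes two half cancellations, as `b` cancels less than half of itself in `b * b`.
  have hac : a.1 = c.1 := by omega
  by_cases hac2 : a.2 = c.2
  · obtain rfl : a = c := Prod.ext hac hac2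
    exact (h.letter hab1).gp_add_gp_lt
  · have h4 := gp_ultra (MagnusKernel.letter ![u, v] b)⁻¹ (MagnusKernel.letter ![u, v] a)⁻¹
      (MagnusKernel.letter ![u, v] b)
    rw [hinv c a hac.symm (Ne.symm hac2)] at h2 ⊢
    omega

end MinimalBad

lemma good_of_closure_eq_top {u v : F 2} (h : Subgroup.closure {u, v} = ⊤) : Good u v := by
  induction hN : u.norm + v.norm using Nat.strong_induction_on generalizing u v with
  | _ N ih =>
    by_contra hbad
    have hmin : MinimalBad u v := ⟨h, hbad, fun u' v' h1 h2 => ih _ (hN ▸ h2) h1 rfl⟩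
    have hrange : Subgroup.closure (Set.range ![u, v]) = ⊤ := by
      rwa [Matrix.range_cons, Matrix.range_cons, Matrix.range_empty, Set.union_empty,
        Set.singleton_union]
    obtain ⟨p, hp⟩ := hmin.nielsenReduced.exists_letter_eq_of hrange 0
    obtain ⟨q, hq⟩ := hmin.nielsenReduced.exists_letter_eq_of hrange 1
    by_cases hpq : p.1 = q.1
    · obtain ⟨i, s⟩ := p
      obtain ⟨j, t⟩ := q
      obtain rfl : i = j := hpq
      have h01 : (of 0 : F 2) = of 1 ∨ (of 0 : F 2) = (of 1)⁻¹ := by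
        rw [← hp, ← hq]
        cases s <;> cases t <;> simp [letter]
      revert h01
      decide
    · have h1 := hmin.letter hpq
      rw [hp, hq] at h1
      exact h1.not_good (Or.inl (Pos.base 0 1 true true (by decide)))

/-! ### Growth of exponent vectors. -/

/-- The exponent sum of `x_i`, as an integer. -/
def intExpSum (i : Fin 2) (u : F 2) : ℤ := Multiplicative.toAdd (expSum i u)

lemma intExpSum_mul (i : Fin 2) (u v : F 2) :
    intExpSum i (u * v) = intExpSum i u + intExpSum i v := by
  simp [intExpSum]

lemma intExpSum_inv (i : Fin 2) (u : F 2) : intExpSum i u⁻¹ = -intExpSum i u := by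
  simp [intExpSum]

lemma intExpSum_conj (i : Fin 2) (g u : F 2) : intExpSum i (g * u * g⁻¹) = intExpSum i u := by
  simp [intExpSum_mul, intExpSum_inv]

lemma intExpSum_of (i j : Fin 2) : intExpSum i (of j) = if j = i then 1 else 0 := by
  rw [intExpSum, expSum_of]
  split_ifs <;> rfl

lemma intExpSum_mk (i j : Fin 2) (s : Bool) :
    intExpSum i (mk [(j, s)]) = if j = i then (if s then 1 else -1) else 0 := by
  cases s
  · have : (mk [(j, false)] : F 2) = (of j)⁻¹ := rfl
    rw [this, intExpSum_inv, intExpSum_of]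
    split_ifs <;> simp_all
  · exact intExpSum_of i j

/-- In a pair satisfying `Pos`, the abelianizations of both entries lie in a common closed orthant,
and they are small only if the pair is conjugate to a basic one. -/
lemma Pos.exists_orthant {u v : F 2} (h : Pos u v) :
    ∃ ε : Fin 2 → ℤ, (∀ k, ε k = 1 ∨ ε k = -1) ∧
      1 ≤ ε 0 * intExpSum 0 u + ε 1 * intExpSum 1 u ∧
      1 ≤ ε 0 * intExpSum 0 v + ε 1 * intExpSum 1 v ∧
      ((∃ g i j s t, i ≠ j ∧ u = g * mk [(i, s)] * g⁻¹ ∧ v = g * mk [(j, t)] * g⁻¹) ∨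
        3 ≤ ε 0 * intExpSum 0 u + ε 1 * intExpSum 1 u +
          (ε 0 * intExpSum 0 v + ε 1 * intExpSum 1 v)) := by
  induction h with
  | base i j s t h =>
    refine ⟨fun k => if k = i then (if s then 1 else -1) else (if t then 1 else -1), ?_, ?_, ?_,
      Or.inl ⟨1, i, j, s, t, h, by simp, by simp⟩⟩
    · intro k
      dsimp only
      split_ifs <;> simp
    · simp only [intExpSum_mk]
      fin_cases i <;> fin_cases j <;> cases s <;> cases t <;> simp_all
    · simp only [intExpSum_mk]
      fin_cases i <;> fin_cases j <;> cases s <;> cases t <;> simp_all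
  | mul_right _ ih =>
    obtain ⟨ε, h1, h2, h3, -⟩ := ih
    refine ⟨ε, h1, h2, ?_, Or.inr ?_⟩ <;> simp only [intExpSum_mul, mul_add] <;> omega
  | mul_left _ ih =>
    obtain ⟨ε, h1, h2, h3, -⟩ := ih
    refine ⟨ε, h1, ?_, h3, Or.inr ?_⟩ <;> simp only [intExpSum_mul, mul_add] <;> omega
  | conj g _ ih =>
    obtain ⟨ε, h1, h2, h3, h4⟩ := ih
    simp only [intExpSum_conj]
    refine ⟨ε, h1, h2, h3, h4.imp ?_ id⟩
    rintro ⟨k, i, j, s, t, hij, rfl, rfl⟩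
    exact ⟨g * k, i, j, s, t, hij, by group, by group⟩

lemma eq_of_of_intExpSum_mk {i j : Fin 2} {s : Bool}
    (h : ∀ k, intExpSum k (mk [(j, s)]) = if i = k then 1 else 0) : (mk [(j, s)] : F 2) = of i := by
  have := h j
  rw [intExpSum_mk, if_pos rfl] at this
  by_cases hij : i = j
  · subst hij
    cases s
    · simp at this
    · rfl
  · cases s <;> simp [hij] at this

/-- The signed exponent sums of both entries total at most 2, even if `u` is inverted. This excludes
the alternative `3 ≤` in `Pos.exists_orthant`. -/
lemma Good.exists_conj {u v : F 2} (h : Good u v)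
    (hu : ∀ k, intExpSum k u = if 0 = k then 1 else 0)
    (hv : ∀ k, intExpSum k v = if 1 = k then 1 else 0) :
    ∃ g, u = g * of 0 * g⁻¹ ∧ v = g * of 1 * g⁻¹ := by
  have key : ∃ g i j s t, u = g * mk [(i, s)] * g⁻¹ ∧ v = g * mk [(j, t)] * g⁻¹ := by
    rcases h with h | h
    · obtain ⟨ε, h1, h2, h3, ⟨g, i, j, s, t, -, h5, h6⟩ | h4⟩ := h.exists_orthant
      · exact ⟨g, i, j, s, t, h5, h6⟩
      · exfalso
        simp [hu, hv] at h4
        have := h1 0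
        have := h1 1
        omega
    · obtain ⟨ε, h1, h2, h3, ⟨g, i, j, s, t, -, h5, h6⟩ | h4⟩ := h.exists_orthant
      · refine ⟨g, i, j, !s, t, ?_, h6⟩
        have : (mk [(i, !s)] : F 2) = (mk [(i, s)])⁻¹ := rfl
        rw [this, ← inv_inv u, h5]
        group
      · exfalso
        simp [hu, hv, intExpSum_inv] at h4
        have := h1 0
        have := h1 1
        omega
  obtain ⟨g, i, j, s, t, rfl, rfl⟩ := key
  simp only [intExpSum_conj] at hu hv
  exact ⟨g, by rw [eq_of_of_intExpSum_mk hu], by rw [eq_of_of_intExpSum_mk hv]⟩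

/-! ### Inner automorphisms of `F_2`. -/

lemma IA_two_eq : IA 2 = (inn (F 2)).range := by
  apply le_antisymm
  · intro σ hσ
    have hgen : Subgroup.closure {act σ (of 0), act σ (of 1)} = ⊤ := by
      have h1 := MonoidHom.map_closure σ.unop.toMonoidHom (Set.range (of : Fin 2 → F 2))
      rw [FreeGroup.closure_range_of, Subgroup.map_top_of_surjective _ σ.unop.surjective,
        ← Set.range_comp] at h1
      rw [h1]
      congr 1
      ext x
      simp [Fin.exists_fin_two, act, eq_comm]
    have hexp (i k : Fin 2) : intExpSum k (act σ (of i)) = if i = k then 1 else 0 := by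
      rw [← intExpSum_of, intExpSum, intExpSum, expSum_congr k (of_act hσ (of i))]
    obtain ⟨g, h0, h1⟩ := (good_of_closure_eq_top hgen).exists_conj (hexp 0) (hexp 1)
    refine ⟨g⁻¹, ?_⟩
    apply MulOpposite.unop_injective
    apply MulEquiv.toMonoidHom_injective
    ext i
    change act (inn (F 2) g⁻¹) (of i) = act σ (of i)
    rw [act_inn, inv_inv]
    fin_cases i
    exacts [h0.symm, h1.symm]
  · rintro _ ⟨g, rfl⟩
    exact inn_mem_IA 2 g

lemma inn_injective : Function.Injective (inn (F 2)) := by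
  rw [injective_iff_map_eq_one]
  intro g hg
  have hcomm (x : F 2) : x * g = g * x := by
    have h1 : act (inn (F 2) g) x = x := by rw [hg]; rfl
    rw [act_inn, mul_assoc, inv_mul_eq_iff_eq_mul] at h1
    exact h1
  by_contra hne
  have hred : FreeGroup.IsReduced g.toWord := FreeGroup.isReduced_toWord
  match hw : g.toWord with
  | [] => exact hne (FreeGroup.toWord_eq_nil_iff.mp hw)
  | a :: L =>
    have hlast := List.getLast?_eq_getLast_of_ne_nil (List.cons_ne_nil a L)
    obtain ⟨z, hz⟩ : ∃ z, z = (a :: L).getLast (List.cons_ne_nil a L) := ⟨_, rfl⟩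
    rw [hw] at hred
    -- The test letter has the other index than the first letter of `g` and the sign of the last, so
    -- it cancels on neither side; the two products then differ in their first letter.
    have hca : FreeGroup.IsReduced ((a.1 + 1, z.2) :: a :: L) := by
      refine List.isChain_cons_cons.mpr ⟨fun h => absurd h ?_, hred⟩
      simp
    have hcz : FreeGroup.IsReduced (a :: L ++ [(a.1 + 1, z.2)]) := by
      refine List.isChain_append.mpr ⟨hred, List.isChain_singleton _, ?_⟩
      intro x hx y hy _
      rw [hlast, ← hz] at hx
      simp at hx hy
      rw [← hx, ← hy]
    have h1 := congrArg FreeGroup.toWord (hcomm (mk [(a.1 + 1, z.2)]))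
    rw [FreeGroup.toWord_mul, FreeGroup.toWord_mul, hw, FreeGroup.toWord_mk,
      FreeGroup.IsReduced.singleton.reduce_eq, List.singleton_append, hca.reduce_eq,
      hcz.reduce_eq, List.cons_append, List.cons.injEq] at h1
    have := congrArg Prod.fst h1.1
    simp at this

end MagnusKernel
end

/-- `IA_2` is the group of inner automorphisms of `F_2`, the map `g ↦ ι_g = (x ↦ g⁻¹ x g)` is an
isomorphism `e` of `F_2` onto `IA_2`, and under it `K_2` is the second derived subgroup. -/
theorem proposition5p1 :
    MagnusKernel.IA 2 = (MagnusKernel.inn (MagnusKernel.F 2)).range ∧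
    ∃ e : MagnusKernel.F 2 ≃* MagnusKernel.IA 2,
      (∀ g : MagnusKernel.F 2,
        (e g : MagnusKernel.Aut (MagnusKernel.F 2)) = MagnusKernel.inn (MagnusKernel.F 2) g) ∧
      MagnusKernel.K 2 =
        (MagnusKernel.secondDerived (MagnusKernel.F 2)).map e.toMonoidHom := by
  refine ⟨MagnusKernel.IA_two_eq,
    (MonoidHom.ofInjective MagnusKernel.inn_injective).trans
      (MulEquiv.subgroupCongr MagnusKernel.IA_two_eq.symm), fun g => rfl, ?_⟩
  ext σ
  rw [Subgroup.mem_map_equiv, MagnusKernel.mem_K_iff]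
  obtain ⟨g, rfl⟩ := ((MonoidHom.ofInjective MagnusKernel.inn_injective).trans
      (MulEquiv.subgroupCongr MagnusKernel.IA_two_eq.symm)).surjective σ
  rw [MulEquiv.symm_apply_apply]
  exact MagnusKernel.magnusMatrix_inn_eq_one_iff le_rfl g
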